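/- Let $S$ be a set and let $\mathcal F$ be a set of finite subsets of $S$ such that $\emptyset\in\mathcal F$, $\{s\}\in\mathcal F$ for every $s\in S$, and $F\cup F'\in\mathcal F$ whenever $F,F'\in\mathcal F$ and $F\cap F'\neq\emptyset$. A set $C\subseteq S$ is *connected* if for all $x,y\in C$ there is $F\in\mathcal F$ with $x,y\in F\subseteq C$. Let $\mathcal C$ be the set of connected sets; $(S,\mathcal C)$ is the *connectoid* induced by $\mathcal F$, and it is *connected* if $S$ is a connected set. The *components* of $A\subseteq S$ are its (nonempty) maximal connected subsets; they partition $A$. A *necklace* is a connected set $N$ for which there are finite connected sets $H_n$ ($n\in\mathbb N$) with $N=\bigcup_n H_n$ and with $H_i\cap H_j\neq\emptyset$ if and only if $|i-j|\le 1$. For a finite set $X\subseteq S$, the *$X$-tail* of $N$ is the unique component of $N\setminus X$ that contains all but finitely many elements of $N$. Two necklaces are *equivalent* if for every finite $X\subseteq S$ their $X$-tails lie in the same component of $S\setminus X$. The *ends* of $(S,\mathcal C)$ are the equivalence classes of necklaces, and $\Omega(S,\mathcal C)$ is the set of ends. For an end $\omega$ and a finite $X\subseteq S$ let $K(X,\omega)$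 be the component of $S\setminus X$ containing the $X$-tails of all necklaces in $\omega$. The topology of $\Omega(S,\mathcal C)$ is generated by the sets $\{\omega\in\Omega(S,\mathcal C): K(X,\omega)=K\}$, where $X\subseteq S$ is finite and $K$ is a component of $S\setminus X$. **Proposition.** Let $(S,\mathcal C)$ be a connected connectoid. For every open cover $U$ of $\Omega(S,\mathcal C)$ there is a partition of $\Omega(S,\mathcal C)$ into nonempty open sets each of which is contained in some element of $U$; that is, $\Omega(S,\mathcal C)$ is ultra-paracompact. -/

import Mathlib

open Set

/-- A connectoid on the ground set `S`, given by an inducing family of finite sets which contains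
the empty set and all singletons and is closed under unions of two intersecting members. -/
structure Connectoid (S : Type*) where
  /-- the inducing family -/
  fam : Set (Set S)
  finite_of_mem : ∀ F ∈ fam, F.Finite
  union_mem : ∀ F ∈ fam, ∀ F' ∈ fam, (F ∩ F').Nonempty → F ∪ F' ∈ fam
  singleton_mem : ∀ s : S, {s} ∈ fam
  empty_mem : ∅ ∈ fam

namespace Connectoid

variable {S : Type*} (c : Connectoid S)

/-- `C` is connected if any two of its elements lie in a common member of the inducing family
that is contained in `C`. -/
def IsConnectedSet (C : Set S) : Prop :=
  ∀ x ∈ C, ∀ y ∈ C, ∃ F ∈ c.fam, F ⊆ C ∧ x ∈ F ∧ y ∈ F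

/-- The connectoid is connected if its ground set is. -/
def Connected : Prop := c.IsConnectedSet univ

/-- `K` is a component of `A`, i.e. a maximal connected subset of `A`. (Nonemptiness only matters
for `A = ∅`, which has no components, so that components always partition `A`.) -/
def IsComponent (A K : Set S) : Prop :=
  K.Nonempty ∧ Maximal (fun C => C ⊆ A ∧ c.IsConnectedSet C) K

/-- `H` is a witness of the necklace `N`. -/
def IsWitness (N : Set S) (H : ℕ → Set S) : Prop :=
  (∀ n, (H n).Finite ∧ c.IsConnectedSet (H n)) ∧ N = ⋃ n, H n ∧
    ∀ i j, (H i ∩ H j).Nonempty ↔ |(i : ℤ) - (j : ℤ)| ≤ 1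

def IsNecklace (N : Set S) : Prop :=
  c.IsConnectedSet N ∧ ∃ H, c.IsWitness N H

/-- `T` is the `X`-tail of `N`: the component of `N \ X` containing all but finitely many elements
of `N`. For necklaces it exists and is unique, see `existsUnique_tail`. -/
def IsTail (X : Finset S) (N T : Set S) : Prop :=
  c.IsComponent (N \ ↑X) T ∧ (N \ T).Finite

/-- Two necklaces are equivalent if for every finite `X` their `X`-tails lie in the same component
of the complement of `X`. -/
def Equivalent (N N' : Set S) : Prop :=
  ∀ X : Finset S, ∃ K, c.IsComponent (↑X)ᶜ K ∧
    (∃ T, c.IsTail X N T ∧ T ⊆ K) ∧ (∃ T', c.IsTail X N' T' ∧ T' ⊆ K)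

variable {c}

theorem isConnectedSet_of_mem {F : Set S} (hF : F ∈ c.fam) : c.IsConnectedSet F :=
  fun _ hx _ hy => ⟨F, hF, Subset.rfl, hx, hy⟩

theorem IsConnectedSet.union {A B : Set S} (hA : c.IsConnectedSet A) (hB : c.IsConnectedSet B)
    (h : (A ∩ B).Nonempty) : c.IsConnectedSet (A ∪ B) := by
  obtain ⟨z, hzA, hzB⟩ := h
  have key : ∀ x ∈ A ∪ B, ∃ F ∈ c.fam, F ⊆ A ∪ B ∧ x ∈ F ∧ z ∈ F := by
    rintro x (hx | hx)
    · obtain ⟨F, hF, h1, h2, h3⟩ := hA x hx z hzA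
      exact ⟨F, hF, h1.trans subset_union_left, h2, h3⟩
    · obtain ⟨F, hF, h1, h2, h3⟩ := hB x hx z hzB
      exact ⟨F, hF, h1.trans subset_union_right, h2, h3⟩
  intro x hx y hy
  obtain ⟨F, hF, h1, h2, h3⟩ := key x hx
  obtain ⟨G, hG, g1, g2, g3⟩ := key y hy
  exact ⟨F ∪ G, c.union_mem F hF G hG ⟨z, h3, g3⟩, union_subset h1 g1, Or.inl h2, Or.inr g2⟩

theorem IsComponent.subset_of_inter {A K C : Set S} (hK : c.IsComponent A K)
    (hC : c.IsConnectedSet C) (hCA : C ⊆ A) (h : (K ∩ C).Nonempty) : C ⊆ K :=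
  subset_union_right.trans
    (hK.2.2 ⟨union_subset hK.2.1.1 hCA, hK.2.1.2.union hC h⟩ subset_union_left)

theorem IsComponent.eq_of_inter {A K K' : Set S} (hK : c.IsComponent A K)
    (hK' : c.IsComponent A K') (h : (K ∩ K').Nonempty) : K = K' :=
  Subset.antisymm (hK'.subset_of_inter hK.2.1.2 hK.2.1.1 (by rwa [inter_comm]))
    (hK.subset_of_inter hK'.2.1.2 hK'.2.1.1 h)

theorem exists_component {A C : Set S} (hC : c.IsConnectedSet C) (hCA : C ⊆ A)
    (hne : C.Nonempty) : ∃ K, c.IsComponent A K ∧ C ⊆ K := by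
  obtain ⟨x, hx⟩ := hne
  set K : Set S := {y | ∃ F ∈ c.fam, F ⊆ A ∧ x ∈ F ∧ y ∈ F} with hKdef
  have hxK : x ∈ K :=
    ⟨{x}, c.singleton_mem x, singleton_subset_iff.2 (hCA hx), mem_singleton x, mem_singleton x⟩
  have hsub : ∀ D : Set S, c.IsConnectedSet D → D ⊆ A → x ∈ D → D ⊆ K := by
    intro D hD hDA hxD y hy
    obtain ⟨F, hF, h1, h2, h3⟩ := hD x hxD y hy
    exact ⟨F, hF, h1.trans hDA, h2, h3⟩
  have hFK : ∀ F ∈ c.fam, F ⊆ A → x ∈ F → F ⊆ K :=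
    fun F hF hFA hxF => hsub F (isConnectedSet_of_mem hF) hFA hxF
  refine ⟨K, ⟨⟨x, hxK⟩, ⟨?_, ?_⟩, ?_⟩, hsub C hC hCA hx⟩
  · rintro y ⟨F, _, h1, _, h3⟩
    exact h1 h3
  · rintro y ⟨F, hF, h1, h2, h3⟩ z ⟨G, hG, g1, g2, g3⟩
    exact ⟨F ∪ G, c.union_mem F hF G hG ⟨x, h2, g2⟩,
      union_subset (hFK F hF h1 h2) (hFK G hG g1 g2), Or.inl h3, Or.inr g3⟩
  · rintro D ⟨hDA, hD⟩ hKD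
    exact hsub D hD hDA (hKD hxK)

theorem IsWitness.nonempty {N : Set S} {H : ℕ → Set S} (h : c.IsWitness N H) (n : ℕ) :
    (H n).Nonempty := by
  have := (h.2.2 n n).2 (by simp)
  rwa [inter_self] at this

theorem IsWitness.index_close {N : Set S} {H : ℕ → Set S} (h : c.IsWitness N H) {i j : ℕ}
    {x : S} (hi : x ∈ H i) (hj : x ∈ H j) : |(i : ℤ) - (j : ℤ)| ≤ 1 :=
  (h.2.2 i j).1 ⟨x, hi, hj⟩

theorem IsNecklace.infinite {N : Set S} (hN : c.IsNecklace N) : N.Infinite := by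
  obtain ⟨_, H, hH⟩ := hN
  choose f hf using hH.nonempty
  have hinj : Function.Injective (fun n => f (2 * n)) := by
    intro a b hab
    have h1 : f (2 * a) ∈ H (2 * b) := by
      have hb := hf (2 * b)
      simp only at hab
      rwa [← hab] at hb
    have := hH.index_close (hf (2 * a)) h1
    rw [abs_le] at this
    push_cast at this
    omega
  refine (infinite_range_of_injective hinj).mono ?_
  rintro _ ⟨n, rfl⟩
  rw [hH.2.1]
  exact mem_iUnion.2 ⟨2 * n, hf _⟩

theorem IsNecklace.exists_tail {N : Set S} (hN : c.IsNecklace N) (X : Finset S) :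
    ∃ T, c.IsTail X N T := by
  obtain ⟨_, H, hH⟩ := hN
  have hm : ∃ m, ∀ n, m ≤ n → Disjoint (H n) (X : Set S) := by
    classical
    induction X using Finset.induction_on with
    | empty => exact ⟨0, by simp⟩
    | insert a X _ ih =>
      obtain ⟨m, hm⟩ := ih
      by_cases ha : ∃ k, a ∈ H k
      · obtain ⟨k, hk⟩ := ha
        refine ⟨max m (k + 2), fun n hn => ?_⟩
        rw [Finset.coe_insert, disjoint_insert_right]
        refine ⟨fun h => ?_, hm n (by omega)⟩
        have := hH.index_close h hk
        rw [abs_le] at this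
        omega
      · refine ⟨m, fun n hn => ?_⟩
        rw [Finset.coe_insert, disjoint_insert_right]
        exact ⟨fun h => ha ⟨n, h⟩, hm n hn⟩
  obtain ⟨m, hm⟩ := hm
  have hsub : ∀ n, m ≤ n → H n ⊆ N \ ↑X := by
    intro n hn x hx
    refine ⟨?_, fun hxX => disjoint_left.1 (hm n hn) hx hxX⟩
    rw [hH.2.1]
    exact mem_iUnion.2 ⟨n, hx⟩
  obtain ⟨K, hK, hmK⟩ := exists_component (hH.1 m).2 (hsub m le_rfl) (hH.nonempty m)
  have hall : ∀ n, m ≤ n → H n ⊆ K := by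
    intro n hn
    induction n, hn using Nat.le_induction with
    | base => exact hmK
    | succ n hn ih =>
      refine hK.subset_of_inter (hH.1 (n + 1)).2 (hsub (n + 1) (by omega)) ?_
      obtain ⟨x, h1, h2⟩ := (hH.2.2 n (n + 1)).2 (by push_cast; rw [abs_le]; omega)
      exact ⟨x, ih h1, h2⟩
  refine ⟨K, hK, ((finite_Iio m).biUnion fun n _ => (hH.1 n).1).subset ?_⟩
  rintro x ⟨hxN, hxK⟩
  rw [hH.2.1] at hxN
  obtain ⟨n, hn⟩ := mem_iUnion.1 hxN
  refine mem_biUnion (x := n) ?_ hn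
  by_contra hlt
  exact hxK (hall n (not_lt.1 hlt) hn)

theorem IsNecklace.existsUnique_tail {N : Set S} (hN : c.IsNecklace N) (X : Finset S) :
    ∃! T, c.IsTail X N T := by
  obtain ⟨T, hT⟩ := hN.exists_tail X
  refine ⟨T, hT, fun T' hT' => hT'.1.eq_of_inter hT.1 ?_⟩
  by_contra hne
  rw [not_nonempty_iff_eq_empty] at hne
  refine hN.infinite ((hT.2.union hT'.2).subset fun x hx => ?_)
  by_contra hx'
  have : x ∈ T' ∩ T := by
    simp only [mem_union, mem_sdiff, not_or, not_and, not_not] at hx'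
    exact ⟨hx'.2 hx, hx'.1 hx⟩
  rw [hne] at this
  exact this

theorem IsNecklace.existsUnique_component {N : Set S} (hN : c.IsNecklace N) (X : Finset S) :
    ∃! K, c.IsComponent (↑X)ᶜ K ∧ ∃ T, c.IsTail X N T ∧ T ⊆ K := by
  obtain ⟨T, hT, huniq⟩ := hN.existsUnique_tail X
  obtain ⟨K, hK, hTK⟩ := exists_component (A := (↑X)ᶜ) hT.1.2.1.2
    (fun x hx => (hT.1.2.1.1 hx).2) hT.1.1
  refine ⟨K, ⟨hK, T, hT, hTK⟩, ?_⟩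
  rintro K' ⟨hK', T', hT', hTK'⟩
  obtain rfl := huniq T' hT'
  obtain ⟨x, hx⟩ := hT'.1.1
  exact hK'.eq_of_inter hK ⟨x, hTK' hx, hTK hx⟩

variable (c)

/-- Equivalence of necklaces, as a setoid on the set of necklaces. -/
instance necklaceSetoid : Setoid {N : Set S // c.IsNecklace N} where
  r N N' := c.Equivalent N.1 N'.1
  iseqv :=
    { refl := fun N X => by
        obtain ⟨K, ⟨hK, hT⟩, _⟩ := N.2.existsUnique_component X
        exact ⟨K, hK, hT, hT⟩
      symm := fun h X => by
        obtain ⟨K, hK, h1, h2⟩ := h X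
        exact ⟨K, hK, h2, h1⟩
      trans := fun {N₁ N₂ N₃} h h' X => by
        obtain ⟨K, hK, h1, h2⟩ := h X
        obtain ⟨K', hK', h1', h2'⟩ := h' X
        obtain rfl := (N₂.2.existsUnique_component X).unique ⟨hK, h2⟩ ⟨hK', h1'⟩
        exact ⟨K, hK, h1, h2'⟩ }

/-- The ends of a connectoid: the equivalence classes of necklaces. -/
def End : Type _ := Quotient c.necklaceSetoid

variable {c}

/-- The end that contains the necklace `N`. -/
def End.mk (N : Set S) (hN : c.IsNecklace N) : c.End := Quotient.mk c.necklaceSetoid ⟨N, hN⟩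

theorem End.existsUnique_component (ω : c.End) (X : Finset S) :
    ∃! K, c.IsComponent (↑X)ᶜ K ∧
      ∀ N (hN : c.IsNecklace N), End.mk N hN = ω → ∃ T, c.IsTail X N T ∧ T ⊆ K := by
  obtain ⟨⟨N, hN⟩, rfl⟩ := Quotient.exists_rep ω
  obtain ⟨K, ⟨hK, hT⟩, huniq⟩ := hN.existsUnique_component X
  refine ⟨K, ⟨hK, fun N' hN' h => ?_⟩, fun K' hK' => huniq K' ⟨hK'.1, hK'.2 N hN rfl⟩⟩
  have hE : c.Equivalent N' N := Quotient.exact h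
  obtain ⟨K', hK', h1, h2⟩ := hE X
  obtain rfl := huniq K' ⟨hK', h2⟩
  exact h1

/-- `K(X, ω)`: the component of the complement of `X` that contains the `X`-tails of all necklaces
in the end `ω`. -/
noncomputable def End.component (ω : c.End) (X : Finset S) : Set S :=
  (ω.existsUnique_component X).choose

/-- The topology of the end space, generated by the sets `{ω | K(X, ω) = K}`, where `X` is finite
and `K` is a component of the complement of `X`. -/
instance : TopologicalSpace c.End :=
  TopologicalSpace.generateFrom
    {B | ∃ (X : Finset S) (K : Set S), c.IsComponent (↑X)ᶜ K ∧ B = {ω : c.End | ω.component X = K}}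

end Connectoid

namespace Connectoid

variable {S : Type*} {c : Connectoid S}

/-! ### Components of ends -/

/-! Call a component of the complement of a finite set losing if its ends have no open partition
refining `U`. Partitions of the pieces glue, so without a partition of all ends some component of S
is losing, and deleting further points leaves a losing component inside each losing one. Yet every
end ω has a finite X for which K(X, ω) is not losing, because a basic neighbourhood of ω lies in a
member of `U`. The contradiction is a necklace running down nested losing components, with end ω,
such that every K(X, ω) contains a losing component.

Nested losing components may share points, so more control is needed. If every losing component is
`Rich`, each bead meets a connected set L; these sets eventually avoid any given finite set, hence
lie in K(X, ω), and a losing component off X still meets them (`not_losing_of_forall_rich`). If K is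
losing but not rich, its losing subcomponents are unique for each finite set and can be cut off from
finite parts of K by finite separators. Separators that are pairwise disjoint in K force the nested
components to have empty intersection, so they end up inside K(X, ω) (`Losing.rich`). -/

theorem IsNecklace.inter_nonempty_of_isTail {N T T' : Set S} {X X' : Finset S}
    (hN : c.IsNecklace N) (hT : c.IsTail X N T) (hT' : c.IsTail X' N T') : (T ∩ T').Nonempty := by
  by_contra hne
  rw [not_nonempty_iff_eq_empty] at hne
  refine hN.infinite ((hT.2.union hT'.2).subset fun x hx => ?_)
  by_cases h : x ∈ T
  · exact Or.inr ⟨hx, fun h' => (hne ▸ (⟨h, h'⟩ : x ∈ T ∩ T') : x ∈ (∅ : Set S))⟩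
  · exact Or.inl ⟨hx, h⟩

theorem End.isComponent (ω : c.End) (X : Finset S) : c.IsComponent (↑X)ᶜ (ω.component X) :=
  (ω.existsUnique_component X).choose_spec.1.1

theorem End.exists_necklace (ω : c.End) : ∃ N, ∃ hN : c.IsNecklace N, End.mk N hN = ω := by
  obtain ⟨⟨N, hN⟩, rfl⟩ := Quotient.exists_rep ω
  exact ⟨N, hN, rfl⟩

theorem End.exists_tail_subset (ω : c.End) (X : Finset S) {N : Set S} {hN : c.IsNecklace N}
    (h : End.mk N hN = ω) : ∃ T, c.IsTail X N T ∧ T ⊆ ω.component X :=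
  (ω.existsUnique_component X).choose_spec.1.2 N hN h

theorem End.component_inter_nonempty (ω : c.End) (X Y : Finset S) :
    (ω.component X ∩ ω.component Y).Nonempty := by
  obtain ⟨N, hN, h⟩ := ω.exists_necklace
  obtain ⟨T, hT, hTX⟩ := ω.exists_tail_subset X h
  obtain ⟨T', hT', hTY⟩ := ω.exists_tail_subset Y h
  exact (hN.inter_nonempty_of_isTail hT hT').mono (inter_subset_inter hTX hTY)

theorem End.component_anti (ω : c.End) {X Y : Finset S} (h : X ⊆ Y) :
    ω.component Y ⊆ ω.component X :=
  (ω.isComponent X).subset_of_inter (ω.isComponent Y).2.1.2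
    ((ω.isComponent Y).2.1.1.trans (compl_subset_compl.2 (by exact_mod_cast h)))
    (ω.component_inter_nonempty X Y)

theorem End.component_eq_of_subset {ω : c.End} {X Y : Finset S} {K : Set S}
    (hK : c.IsComponent (↑X)ᶜ K) (h : ω.component Y ⊆ K) : ω.component X = K := by
  obtain ⟨x, hx, hy⟩ := ω.component_inter_nonempty X Y
  exact (ω.isComponent X).eq_of_inter hK ⟨x, hx, h hy⟩

theorem End.isOpen_setOf_component_eq (X : Finset S) (K : Set S) :
    IsOpen {ω : c.End | ω.component X = K} := by
  by_cases hK : c.IsComponent (↑X)ᶜ K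
  · exact TopologicalSpace.isOpen_generateFrom_of_mem ⟨X, K, hK, rfl⟩
  · convert isOpen_empty
    refine eq_empty_of_forall_notMem fun ω hω => hK ?_
    rw [← show ω.component X = K from hω]
    exact ω.isComponent X

theorem End.exists_setOf_component_eq_subset {u : Set c.End} (hu : IsOpen u) {ω : c.End}
    (hω : ω ∈ u) : ∃ X : Finset S, {ω' : c.End | ω'.component X = ω.component X} ⊆ u := by
  classical
  have hmono : ∀ {X Y : Finset S}, X ⊆ Y → {ω' : c.End | ω'.component Y = ω.component Y} ⊆
      {ω' : c.End | ω'.component X = ω.component X} := fun {X Y} hXY ω' hω' =>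
    End.component_eq_of_subset (ω.isComponent X)
      ((show ω'.component Y = ω.component Y from hω').trans_subset (ω.component_anti hXY))
  induction hu with
  | basic s hs =>
    obtain ⟨X, K, _, rfl⟩ := hs
    exact ⟨X, fun ω' hω' => Eq.trans hω' hω⟩
  | univ => exact ⟨∅, subset_univ _⟩
  | inter s t _ _ ihs iht =>
    obtain ⟨X, hX⟩ := ihs hω.1
    obtain ⟨Y, hY⟩ := iht hω.2
    exact ⟨X ∪ Y, subset_inter ((hmono Finset.subset_union_left).trans hX)
      ((hmono Finset.subset_union_right).trans hY)⟩
  | sUnion A _ ih =>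
    obtain ⟨s, hs, hωs⟩ := hω
    obtain ⟨X, hX⟩ := ih s hs hωs
    exact ⟨X, hX.trans (subset_sUnion_of_mem hs)⟩

/-! ### Finite connected sets and necklaces -/

theorem IsConnectedSet.exists_finite_superset {K P : Set S} (hK : c.IsConnectedSet K)
    (hne : K.Nonempty) (hP : P.Finite) (hPK : P ⊆ K) :
    ∃ H : Set S, H.Finite ∧ c.IsConnectedSet H ∧ P ⊆ H ∧ H ⊆ K ∧ H.Nonempty := by
  obtain ⟨z, hz⟩ := hne
  suffices ∃ H : Set S, H.Finite ∧ c.IsConnectedSet H ∧ P ⊆ H ∧ H ⊆ K ∧ z ∈ H by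
    obtain ⟨H, h1, h2, h3, h4, h5⟩ := this
    exact ⟨H, h1, h2, h3, h4, z, h5⟩
  induction P, hP using Set.Finite.induction_on with
  | empty =>
    exact ⟨{z}, finite_singleton z, isConnectedSet_of_mem (c.singleton_mem z), empty_subset _,
      singleton_subset_iff.2 hz, rfl⟩
  | @insert a P _ _ ih =>
    obtain ⟨H, h1, h2, h3, h4, h5⟩ := ih ((subset_insert a P).trans hPK)
    obtain ⟨F, hF, f1, f2, f3⟩ := hK a (hPK (mem_insert a P)) z hz
    exact ⟨H ∪ F, h1.union (c.finite_of_mem F hF),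
      h2.union (isConnectedSet_of_mem hF) ⟨z, h5, f3⟩,
      insert_subset (Or.inr f2) (h3.trans subset_union_left), union_subset h4 f1, Or.inl h5⟩

/-- The compatibility of consecutive members of a sequence of finite connected sets `G` chosen in
a decreasing sequence of sets `K`, where `P` is the part of `K` touched by earlier members. -/
structure Link (c : Connectoid S) (K P K' P' G : Set S) : Prop where
  finite : G.Finite
  connected : c.IsConnectedSet G
  touched_subset : P ⊆ G
  subset : G ⊆ K
  anti : K' ⊆ K
  inter_subset : G ∩ K' ⊆ P'
  inter_nonempty : (G ∩ P').Nonempty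
  disjoint : Disjoint P K'

/-- Consecutive sets meet in the touched part P of the later one. Whatever G i shares with K (i + 1)
lies in P (i + 1), which misses K (i + 2), so G i misses every G j with j ≥ i + 2. -/
theorem Link.isWitness {K P G : ℕ → Set S}
    (h : ∀ n, c.Link (K n) (P n) (K (n + 1)) (P (n + 1)) (G n)) : c.IsWitness (⋃ n, G n) G := by
  have hK : Antitone K := antitone_nat_of_succ_le fun n => (h n).anti
  have hfar : ∀ i j, i + 2 ≤ j → ¬ (G i ∩ G j).Nonempty := by
    rintro i j hij ⟨x, hi, hj⟩
    have hx : x ∈ K (i + 2) := hK hij ((h j).subset hj)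
    exact disjoint_left.1 (h (i + 1)).disjoint
      ((h i).inter_subset ⟨hi, (h (i + 1)).anti hx⟩) hx
  have hsucc : ∀ i, (G i ∩ G (i + 1)).Nonempty := fun i =>
    (h i).inter_nonempty.mono (inter_subset_inter_right _ (h (i + 1)).touched_subset)
  refine ⟨fun n => ⟨(h n).finite, (h n).connected⟩, rfl, fun i j => ⟨fun hij => ?_, fun hij => ?_⟩⟩
  · rw [abs_le]
    by_contra hcon
    rcases lt_or_ge i j with hlt | hge
    · exact hfar i j (by omega) hij
    · exact hfar j i (by omega) (by rwa [inter_comm])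
  · rw [abs_le] at hij
    obtain rfl | rfl | rfl : j = i ∨ j = i + 1 ∨ i = j + 1 := by omega
    · obtain ⟨x, hx, _⟩ := (h j).inter_nonempty
      exact ⟨x, hx, hx⟩
    · exact hsucc i
    · rw [inter_comm]
      exact hsucc j

theorem IsWitness.isNecklace {N : Set S} {G : ℕ → Set S} (h : c.IsWitness N G) :
    c.IsNecklace N := by
  have hpart : ∀ n, ∃ C : Set S, c.IsConnectedSet C ∧ C ⊆ N ∧ ∀ i ≤ n, G i ⊆ C := by
    have hGN : ∀ n, G n ⊆ N := fun n => h.2.1 ▸ subset_iUnion G n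
    intro n
    induction n with
    | zero => exact ⟨G 0, (h.1 0).2, hGN 0, fun i hi => by rw [Nat.le_zero.1 hi]⟩
    | succ n ih =>
      obtain ⟨C, h1, h2, h3⟩ := ih
      obtain ⟨x, hx, hx'⟩ := (h.2.2 n (n + 1)).2 (by push_cast; rw [abs_le]; omega)
      refine ⟨C ∪ G (n + 1), h1.union (h.1 (n + 1)).2 ⟨x, h3 n le_rfl hx, hx'⟩,
        union_subset h2 (hGN _), fun i hi => ?_⟩
      rcases Nat.lt_or_ge n i with hlt | hge
      · rw [show i = n + 1 by omega]
        exact subset_union_right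
      · exact (h3 i hge).trans subset_union_left
  refine ⟨fun x hx y hy => ?_, G, h⟩
  obtain ⟨i, hi⟩ := mem_iUnion.1 (h.2.1 ▸ hx)
  obtain ⟨j, hj⟩ := mem_iUnion.1 (h.2.1 ▸ hy)
  obtain ⟨C, h1, h2, h3⟩ := hpart (max i j)
  obtain ⟨F, hF, f1, f2⟩ := h1 x (h3 i (le_max_left _ _) hi) y (h3 j (le_max_right _ _) hj)
  exact ⟨F, hF, f1.trans h2, f2⟩

theorem exists_forall_disjoint_of_finite {α : Type*} {A : ℕ → Set α}
    (hA : ∀ x, ∃ m, ∀ n ≥ m, x ∉ A n) {B : Set α} (hB : B.Finite) :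
    ∃ m, ∀ n ≥ m, Disjoint (A n) B := by
  choose m hm using hA
  obtain ⟨M, hM⟩ := (hB.image m).bddAbove
  exact ⟨M, fun n hn => disjoint_left.2 fun x hx hxB =>
    hm x n ((hM (mem_image_of_mem m hxB)).trans hn) hx⟩

/-- Late beads avoid X and the finitely many points outside the X-tail, so they lie in the tail and
hence in its component. -/
theorem IsWitness.exists_end {N : Set S} {G : ℕ → Set S} (h : c.IsWitness N G) :
    ∃ ω : c.End, ∀ X : Finset S, ∃ m, ∀ n ≥ m, G n ⊆ ω.component X := by
  refine ⟨End.mk N h.isNecklace, fun X => ?_⟩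
  obtain ⟨T, hT, hTK⟩ := End.exists_tail_subset (End.mk N h.isNecklace) X rfl
  have hfin : ∀ x, ∃ m, ∀ n ≥ m, x ∉ G n := by
    intro x
    by_cases hx : ∃ k, x ∈ G k
    · obtain ⟨k, hk⟩ := hx
      refine ⟨k + 2, fun n hn hxn => ?_⟩
      have := h.index_close hxn hk
      rw [abs_le] at this
      omega
    · exact ⟨0, fun n _ hn => hx ⟨n, hn⟩⟩
  obtain ⟨m, hm⟩ := exists_forall_disjoint_of_finite hfin (hT.2.union X.finite_toSet)
  refine ⟨m, fun n hn => ?_⟩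
  obtain ⟨hd, hdX⟩ := disjoint_union_right.1 (hm n hn)
  refine (End.isComponent _ X).subset_of_inter (h.1 n).2 (subset_compl_iff_disjoint_right.2 hdX) ?_
  obtain ⟨x, hx⟩ := h.nonempty n
  refine ⟨x, hTK ?_, hx⟩
  by_contra hxT
  exact disjoint_left.1 hd hx ⟨h.2.1 ▸ mem_iUnion.2 ⟨n, hx⟩, hxT⟩

/-! ### Refinable sets of ends and losing components -/

/-- `O` has a partition into open sets refining `U`, where `f ω` is the class of `ω`. -/
def Refinable (U : Set (Set c.End)) (O : Set c.End) : Prop :=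
  ∃ f : c.End → Set c.End, ∀ ω ∈ O, ω ∈ f ω ∧ IsOpen (f ω) ∧ f ω ⊆ O ∧ (∃ u ∈ U, f ω ⊆ u) ∧
    ∀ ω' ∈ f ω, f ω' = f ω

theorem Refinable.mono {U : Set (Set c.End)} {O O' : Set c.End} (h : Refinable U O)
    (hO' : IsOpen O') (hsub : O' ⊆ O) : Refinable U O' := by
  obtain ⟨f, hf⟩ := h
  refine ⟨fun ω => f ω ∩ O', fun ω hω => ?_⟩
  obtain ⟨h1, h2, h3, ⟨u, hu, h4⟩, h5⟩ := hf ω (hsub hω)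
  refine ⟨⟨h1, hω⟩, h2.inter hO', inter_subset_right, ⟨u, hu, inter_subset_left.trans h4⟩,
    fun ω' hω' => ?_⟩
  simp only [h5 ω' hω'.1]

theorem refinable_of_subset {U : Set (Set c.End)} {O u : Set c.End} (hO : IsOpen O) (hu : u ∈ U)
    (h : O ⊆ u) : Refinable U O :=
  ⟨fun _ => O, fun _ hω => ⟨hω, hO, Subset.rfl, ⟨u, hu, h⟩, fun _ _ => rfl⟩⟩

theorem refinable_of_components {U : Set (Set c.End)} {O : Set c.End} (X : Finset S)
    (hO : ∀ ω ∈ O, {ω' : c.End | ω'.component X = ω.component X} ⊆ O)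
    (h : ∀ ω ∈ O, Refinable U {ω' : c.End | ω'.component X = ω.component X}) :
    Refinable U O := by
  classical
  -- The partition is chosen once per component, not per end, so that ends with the same component
  -- use the same classes.
  have h' : ∀ K : Set S, ∃ f : c.End → Set c.End, (∃ ω ∈ O, ω.component X = K) →
      ∀ ω ∈ {ω' : c.End | ω'.component X = K}, ω ∈ f ω ∧ IsOpen (f ω) ∧
        f ω ⊆ {ω' : c.End | ω'.component X = K} ∧ (∃ u ∈ U, f ω ⊆ u) ∧
        ∀ ω' ∈ f ω, f ω' = f ω := by
    intro K
    by_cases hK : ∃ ω ∈ O, ω.component X = K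
    · obtain ⟨ω, hω, rfl⟩ := hK
      obtain ⟨f, hf⟩ := h ω hω
      exact ⟨f, fun _ => hf⟩
    · exact ⟨fun _ => ∅, fun hK' => absurd hK' hK⟩
  choose f hf using h'
  refine ⟨fun ω => f (ω.component X) ω, fun ω hω => ?_⟩
  obtain ⟨h1, h2, h3, h4, h5⟩ := hf _ ⟨ω, hω, rfl⟩ ω rfl
  refine ⟨h1, h2, h3.trans (hO ω hω), h4, fun ω' hω' => ?_⟩
  have : ω'.component X = ω.component X := h3 hω'
  simp only [this, h5 ω' hω']

theorem Refinable.exists_partition {U : Set (Set c.End)} (h : Refinable U univ) :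
    ∃ P : Set (Set c.End), Setoid.IsPartition P ∧ (∀ p ∈ P, IsOpen p) ∧
      ∀ p ∈ P, ∃ u ∈ U, p ⊆ u := by
  obtain ⟨f, hf⟩ := h
  refine ⟨range f, ⟨?_, fun ω => ⟨f ω, ⟨⟨ω, rfl⟩, (hf ω trivial).1⟩, ?_⟩⟩, ?_, ?_⟩
  · rintro ⟨ω, hω⟩
    exact (hω ▸ (hf ω trivial).1 : ω ∈ (∅ : Set c.End))
  · rintro _ ⟨⟨ω', rfl⟩, hω⟩
    exact ((hf ω' trivial).2.2.2.2 ω hω).symm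
  · rintro _ ⟨ω, rfl⟩
    exact (hf ω trivial).2.1
  · rintro _ ⟨ω, rfl⟩
    exact (hf ω trivial).2.2.2.1

/-- `K` is a component of the complement of `X` whose set of ends is not refinable. -/
def Losing (U : Set (Set c.End)) (X : Finset S) (K : Set S) : Prop :=
  c.IsComponent (↑X)ᶜ K ∧ ¬ Refinable U {ω : c.End | ω.component X = K}

section Losing

variable {U : Set (Set c.End)} {X Y : Finset S} {K K' : Set S}

/-- A partition for the larger component would restrict to the smaller one. -/
theorem Losing.mono (h : Losing U Y K') (hK : c.IsComponent (↑X)ᶜ K) (hsub : K' ⊆ K) :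
    Losing U X K :=
  ⟨hK, fun hr => h.2 (hr.mono (End.isOpen_setOf_component_eq Y K') fun ω hω =>
    End.component_eq_of_subset hK ((show ω.component Y = K' from hω).trans_subset hsub))⟩

theorem Losing.exists_subset (h : Losing U X K) (hXY : X ⊆ Y) : ∃ K' ⊆ K, Losing U Y K' := by
  by_contra! hcon
  refine h.2 (refinable_of_components Y (fun ω hω ω' hω' => ?_) fun ω hω => ?_)
  · refine End.component_eq_of_subset h.1 ((show ω'.component Y = _ from hω').trans_subset ?_)
    exact (ω.component_anti hXY).trans_eq hω
  · by_contra hr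
    exact hcon _ ((ω.component_anti hXY).trans_eq hω) ⟨ω.isComponent Y, hr⟩

theorem End.exists_not_losing (hopen : ∀ u ∈ U, IsOpen u) (hcover : ⋃₀ U = univ) (ω : c.End) :
    ∃ X : Finset S, ¬ Losing U X (ω.component X) := by
  obtain ⟨u, hu, hω⟩ := hcover.symm ▸ mem_univ ω
  obtain ⟨X, hX⟩ := End.exists_setOf_component_eq_subset (hopen u hu) hω
  exact ⟨X, fun h => h.2 (refinable_of_subset (End.isOpen_setOf_component_eq _ _) hu hX)⟩

theorem Losing.disjoint (h : Losing U X K) : Disjoint K X :=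
  subset_compl_iff_disjoint_right.1 h.1.2.1.1

/-- Every losing component contains a losing component reached by the next member of a linked
sequence. -/
theorem Losing.exists_link {P L : Set S} (h : Losing U X K) (hP : P.Finite) (hPK : P ⊆ K)
    (hL : L ⊆ K) (hLne : L.Nonempty) (hK' : Losing U Y K') (hK'K : K' ⊆ K)
    (hLK' : (L ∩ K').Finite) :
    ∃ (Z : Finset S) (K'' P' G : Set S), Losing U Z K'' ∧ P'.Finite ∧ P' ⊆ K'' ∧ Y ⊆ Z ∧
      P ⊆ Z ∧ K'' ⊆ K' ∧ c.Link K P K'' P' G ∧ L ∩ K'' ⊆ P' ∧ (G ∩ L).Nonempty := by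
  classical
  obtain ⟨l, hl⟩ := hLne
  obtain ⟨H, h1, h2, h3, h4, h5⟩ := h.1.2.1.2.exists_finite_superset h.1.1
    (hP.insert l) (insert_subset (hL hl) hPK)
  -- Deleting H as well leaves F as the only part of the bead H ∪ F that can enter K''. The touched
  -- part also records L ∩ K'', which is finite by `hLK'`.
  obtain ⟨K'', hK''K', hK''⟩ :=
    hK'.exists_subset (Y := Y ∪ h1.toFinset) Finset.subset_union_left
  have hZ : (↑(Y ∪ h1.toFinset) : Set S) = ↑Y ∪ H := by simp
  have hPZ : P ⊆ ((Y ∪ h1.toFinset : Finset S) : Set S) :=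
    hZ ▸ ((subset_insert l P).trans h3).trans subset_union_right
  have hHK'' : Disjoint H K'' := hK''.disjoint.symm.mono_left (hZ ▸ subset_union_right)
  obtain ⟨k, hk⟩ := hK''.1.1
  obtain ⟨F, hF, f1, f2, f3⟩ := h.1.2.1.2 l (hL hl) k (hK'K (hK''K' hk))
  have hlH : l ∈ H := h3 (mem_insert l P)
  have hFfin := c.finite_of_mem F hF
  refine ⟨Y ∪ h1.toFinset, K'', (F ∪ L) ∩ K'', H ∪ F, hK'', ?_, inter_subset_right,
    Finset.subset_union_left, hPZ, hK''K',
    ⟨h1.union hFfin, h2.union (isConnectedSet_of_mem hF) ⟨l, hlH, f2⟩,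
      ((subset_insert l P).trans h3).trans subset_union_left, union_subset h4 f1,
      hK''K'.trans hK'K, ?_, ⟨k, Or.inr f3, Or.inl f3, hk⟩,
      hK''.disjoint.symm.mono_left hPZ⟩,
    inter_subset_inter_left _ subset_union_right, ⟨l, Or.inl hlH, hl⟩⟩
  · rw [union_inter_distrib_right]
    exact (hFfin.inter_of_left _).union (hLK'.subset (inter_subset_inter_right _ hK''K'))
  · rintro x ⟨hx | hx, hxK⟩
    · exact absurd hxK (disjoint_left.1 hHK'' hx)
    · exact ⟨Or.inl hx, hxK⟩

/-- A connected set `L` in `K` which no finite set disjoint from `L` can separate from all losing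
components, and which is almost disjoint from some losing component in `K`. -/
def Rich (U : Set (Set c.End)) (X : Finset S) (K : Set S) : Prop :=
  ∃ (L : Set S) (Y : Finset S) (K' : Set S), L ⊆ K ∧ L.Nonempty ∧ c.IsConnectedSet L ∧ K' ⊆ K ∧ Losing U Y K' ∧
    (L ∩ K').Finite ∧
    ∀ Z : Finset S, X ⊆ Z → Disjoint L Z → ∃ K'', Losing U Z K'' ∧ (K'' ∩ L).Nonempty

/-! ### Necklaces through nested losing components -/

theorem exists_seq_of_forall_exists {α : Type*} {p : α → Prop} {r : α → α → Prop} {a : α}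
    (ha : p a) (h : ∀ a, p a → ∃ b, p b ∧ r a b) :
    ∃ f : ℕ → α, f 0 = a ∧ (∀ n, p (f n)) ∧ ∀ n, r (f n) (f (n + 1)) := by
  choose g hg hr using h
  let f : ℕ → {a // p a} := fun n => Nat.rec ⟨a, ha⟩ (fun _ b => ⟨g b.1 b.2, hg b.1 b.2⟩) n
  exact ⟨fun n => (f n).1, rfl, fun n => (f n).2, fun n => hr (f n).1 (f n).2⟩

theorem not_losing_of_forall_rich (hopen : ∀ u ∈ U, IsOpen u) (hcover : ⋃₀ U = univ)
    (hrich : ∀ (X : Finset S) (K : Set S), Losing U X K → Rich U X K) : ¬ Losing U X K := by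
  classical
  intro h
  obtain ⟨f, -, hp, hr⟩ := exists_seq_of_forall_exists
    (p := fun s : Finset S × Set S × Set S => Losing U s.1 s.2.1 ∧ s.2.2.Finite ∧ s.2.2 ⊆ s.2.1)
    (r := fun s t => ∃ G L : Set S, c.Link s.2.1 s.2.2 t.2.1 t.2.2 G ∧ L ⊆ s.2.1 ∧
      c.IsConnectedSet L ∧ L ∩ t.2.1 ⊆ t.2.2 ∧ (G ∩ L).Nonempty ∧
      ∀ Z : Finset S, s.1 ⊆ Z → Disjoint L Z → ∃ K'', Losing U Z K'' ∧ (K'' ∩ L).Nonempty)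
    (a := (X, K, ∅)) ⟨h, finite_empty, empty_subset _⟩ (by
      rintro ⟨X, K, P⟩ ⟨hK, hP, hPK⟩
      obtain ⟨L, Y, K', h1, h2, h3, h5, h6, h7, h8⟩ := hrich X K hK
      obtain ⟨Z, K'', P', G, g1, g2, g3, g4, g5, g6, g7, g8, g9⟩ :=
        hK.exists_link hP hPK h1 h2 h6 h5 h7
      exact ⟨(Z, K'', P'), ⟨g1, g2, g3⟩, G, L, g7, h1, h3, g8, g9, h8⟩)
  choose G L hlink hLK hLc hLP hGL hL using hr
  obtain ⟨ω, hω⟩ := (Link.isWitness hlink).exists_end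
  obtain ⟨X, hX⟩ := ω.exists_not_losing hopen hcover
  have hanti : Antitone fun n => (f n).2.1 := antitone_nat_of_succ_le fun n => (hlink n).anti
  have hfin : ∀ x, ∃ m, ∀ n ≥ m, x ∉ L n := by
    intro x
    by_cases hx : ∃ k, x ∈ L k
    · obtain ⟨k, hk⟩ := hx
      refine ⟨k + 2, fun n hn hxn => ?_⟩
      -- A point of L k still in K (k + 1) is touched there, hence gone from K (k + 2).
      have hxK : x ∈ (f (k + 2)).2.1 := hanti hn (hLK n hxn)
      exact disjoint_left.1 (hlink (k + 1)).disjoint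
        (hLP k ⟨hk, (hlink (k + 1)).anti hxK⟩) hxK
    · exact ⟨0, fun n _ hn => hx ⟨n, hn⟩⟩
  obtain ⟨m, hm⟩ := exists_forall_disjoint_of_finite hfin X.finite_toSet
  obtain ⟨m', hm'⟩ := hω X
  have hd := hm (max m m') (le_max_left _ _)
  have hG := hm' (max m m') (le_max_right _ _)
  generalize max m m' = n at hd hG
  have hLX : L n ⊆ ω.component X :=
    (ω.isComponent X).subset_of_inter (hLc n) (subset_compl_iff_disjoint_right.2 hd)
      ((hGL n).mono (inter_subset_inter_left _ hG))
  obtain ⟨K'', hK'', hne⟩ := hL n ((f n).1 ∪ X) Finset.subset_union_left (by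
    rw [Finset.coe_union, disjoint_union_right]
    exact ⟨(hp n).1.disjoint.mono_left (hLK n), hd⟩)
  refine hX (hK''.mono (ω.isComponent X) ((ω.isComponent X).subset_of_inter hK''.1.2.1.2
    (hK''.1.2.1.1.trans ?_) ?_))
  · exact compl_subset_compl.2 (by exact_mod_cast Finset.subset_union_right)
  · rw [inter_comm]
    exact hne.mono (inter_subset_inter_right _ hLX)

/-- If K₁ and K₂ were distinct, they would be disjoint and L = K₂ would witness richness: a finite
set avoiding K₂ leaves it inside a single component, which is then losing. -/
theorem Losing.eq_of_not_rich {K₁ K₂ : Set S} (hn : ¬ Rich U X K) (h₁ : Losing U Y K₁)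
    (h₁K : K₁ ⊆ K) (h₂ : Losing U Y K₂) (h₂K : K₂ ⊆ K) : K₁ = K₂ := by
  by_contra hne
  have hempty : K₂ ∩ K₁ = ∅ := by
    by_contra h
    exact hne (h₂.1.eq_of_inter h₁.1 (nonempty_iff_ne_empty.2 h)).symm
  refine hn ⟨K₂, Y, K₁, h₂K, h₂.1.1, h₂.1.2.1.2, h₁K, h₁, hempty ▸ finite_empty,
    fun Z _ hd => ?_⟩
  obtain ⟨K'', hK'', hsub⟩ := exists_component h₂.1.2.1.2
    (subset_compl_iff_disjoint_right.2 hd) h₂.1.1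
  exact ⟨K'', h₂.mono hK'' hsub, h₂.1.1.mono (subset_inter hsub Subset.rfl)⟩

/-- Otherwise a finite connected superset of L in K witnesses richness, with K itself as the losing
component. -/
theorem Losing.exists_disjoint_of_not_rich (h : Losing U X K) (hn : ¬ Rich U X K) {L : Set S}
    (hL : L.Finite) (hLK : L ⊆ K) :
    ∃ (Y : Finset S) (K' : Set S), Losing U Y K' ∧ K' ⊆ K ∧ Disjoint L Y ∧
      Disjoint L K' := by
  obtain ⟨H, h1, h2, h3, h4, h5⟩ := h.1.2.1.2.exists_finite_superset h.1.1 hL hLK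
  by_contra! hcon
  refine hn ⟨H, X, K, h4, h5, h2, Subset.rfl, h, h1.inter_of_left _,
    fun Z hXZ hd => ?_⟩
  obtain ⟨K', hK'K, hK'⟩ := h.exists_subset hXZ
  refine ⟨K', hK', ?_⟩
  obtain ⟨x, hxL, hxK'⟩ := not_disjoint_iff.1 (hcon Z K' hK' hK'K (hd.mono_left h3))
  exact ⟨x, hxK', h3 hxL⟩

theorem Losing.rich (hopen : ∀ u ∈ U, IsOpen u) (hcover : ⋃₀ U = univ) (h : Losing U X K) :
    Rich U X K := by
  classical
  by_contra hn
  obtain ⟨a, ha⟩ := h.1.1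
  obtain ⟨f, hf0, hp, hr⟩ := exists_seq_of_forall_exists
    (p := fun s : Finset S × Set S × Set S =>
      s.2.1 ⊆ K ∧ Losing U s.1 s.2.1 ∧ s.2.2.Finite ∧ s.2.2 ⊆ s.2.1)
    (r := fun s t => ∃ (G : Set S) (Y : Finset S) (C : Set S),
      c.Link s.2.1 s.2.2 t.2.1 t.2.2 G ∧ s.1 ⊆ t.1 ∧ s.2.2 ⊆ t.1 ∧ Y ⊆ t.1 ∧
      c.IsComponent (↑Y)ᶜ C ∧ t.2.1 ⊆ C ∧ Disjoint (↑s.1 ∩ K) ↑Y ∧ Disjoint (↑s.1 ∩ K) C)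
    (a := (X, K, {a})) ⟨Subset.rfl, h, finite_singleton a,
      singleton_subset_iff.2 ha⟩ (by
      rintro ⟨X₁, K₁, P₁⟩ ⟨hK₁K, hK₁, hP, hPK⟩
      obtain ⟨Y, C, hC, hCK, hdY, hdC⟩ := h.exists_disjoint_of_not_rich hn
        (X₁.finite_toSet.inter_of_left K) inter_subset_right
      -- Losing components off X₁ ∪ Y exist inside both K₁ and C; uniqueness makes them equal, so
      -- the sequence can descend into both at once.
      obtain ⟨K', hK'K₁, hK'⟩ := hK₁.exists_subset (Y := X₁ ∪ Y) Finset.subset_union_left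
      obtain ⟨K'', hK''C, hK''⟩ := hC.exists_subset (Y := X₁ ∪ Y) Finset.subset_union_right
      obtain rfl := hK'.eq_of_not_rich hn
        (hK'K₁.trans hK₁K) hK'' (hK''C.trans hCK)
      obtain ⟨x, hx⟩ := hK₁.1.1
      obtain ⟨Z, K'', P', G, g1, g2, g3, g4, g5, g6, g7, -, -⟩ :=
        hK₁.exists_link hP hPK (singleton_subset_iff.2 hx) (singleton_nonempty x)
          hK' hK'K₁ ((finite_singleton x).inter_of_left _)
      exact ⟨(Z, K'', P'), ⟨(g6.trans hK'K₁).trans hK₁K, g1, g2, g3⟩, G, Y, C, g7,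
        Finset.subset_union_left.trans g4, g5, Finset.subset_union_right.trans g4, hC.1,
        g6.trans hK''C, hdY, hdC⟩)
  choose G Y C hlink hXX hPX hYX hC hKC hdY hdC using hr
  obtain ⟨ω, hω⟩ := (Link.isWitness hlink).exists_end
  obtain ⟨Z, hZ⟩ := ω.exists_not_losing hopen hcover
  have hanti : Antitone fun n => (f n).2.1 := antitone_nat_of_succ_le fun n => (hlink n).anti
  have hmono : Monotone fun n => (f n).1 := monotone_nat_of_le_succ hXX
  have haX : ∀ n, a ∈ (f (n + 1)).1 := fun n =>
    hmono (Nat.succ_le_succ n.zero_le) (by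
      have := hPX 0
      rw [hf0] at this
      exact this rfl)
  have hfin : ∀ x, ∃ m, ∀ n ≥ m, x ∉ (f n).2.1 := by
    intro z
    by_contra! hz
    have hz' : ∀ n, z ∈ (f n).2.1 := fun n => by
      obtain ⟨k, hk, hzk⟩ := hz n
      exact hanti hk hzk
    obtain ⟨F, hF, f1, f2, f3⟩ := h.1.2.1.2 a ha z ((hp 0).1 (hz' 0))
    -- C (n + 1) contains z but not a, so the connected set F joining them must meet the separator Y
    -- (n + 1). The shift by one is there because a enters the deleted set only at stage 1.
    have hmeet : ∀ n, ∃ p ∈ F, p ∈ Y (n + 1) := by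
      intro n
      by_contra! hcon
      exact disjoint_left.1 (hdC (n + 1)) ⟨haX n, ha⟩
        ((hC (n + 1)).subset_of_inter (isConnectedSet_of_mem hF) (fun p hp => hcon p hp)
          ⟨z, hKC (n + 1) (hz' (n + 2)), f3⟩ f2)
    choose q hqF hqY using hmeet
    -- Earlier separators are part of the deleted set, whose trace on K is avoided by each later
    -- separator; so the finite set F would contain infinitely many points.
    have hlt : ∀ i j, i < j → q i ≠ q j := fun i j hij heq =>
      disjoint_left.1 (hdY (j + 1))
        ⟨hmono (show i + 1 + 1 ≤ j + 1 by omega) (hYX (i + 1) (hqY i)), f1 (hqF i)⟩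
        (heq ▸ hqY j)
    have hinj : Function.Injective q := fun i j hij => by
      rcases lt_trichotomy i j with hl | he | hl
      · exact absurd hij (hlt i j hl)
      · exact he
      · exact absurd hij.symm (hlt j i hl)
    exact infinite_range_of_injective hinj
      ((c.finite_of_mem F hF).subset (range_subset_iff.2 hqF))
  obtain ⟨m, hm⟩ := exists_forall_disjoint_of_finite hfin Z.finite_toSet
  obtain ⟨m', hm'⟩ := hω Z
  have hd := hm (max m m') (le_max_left _ _)
  have hG := hm' (max m m') (le_max_right _ _)
  generalize max m m' = n at hd hG
  obtain ⟨x, hx, -⟩ := (hlink n).inter_nonempty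
  exact hZ ((hp n).2.1.mono (ω.isComponent Z) ((ω.isComponent Z).subset_of_inter
    (hp n).2.1.1.2.1.2 (subset_compl_iff_disjoint_right.2 hd)
    ⟨x, hG hx, (hlink n).subset hx⟩))

end Losing

end Connectoid

theorem mainTheorem7 {S : Type*} (c : Connectoid S) (hc : c.Connected)
    (U : Set (Set c.End)) (hopen : ∀ u ∈ U, IsOpen u) (hcover : ⋃₀ U = Set.univ) :
    ∃ P : Set (Set c.End), Setoid.IsPartition P ∧ (∀ p ∈ P, IsOpen p) ∧
      ∀ p ∈ P, ∃ u ∈ U, p ⊆ u := by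
  refine (Connectoid.refinable_of_components ∅ (fun _ _ => subset_univ _)
    fun ω _ => ?_).exists_partition
  by_contra hr
  exact Connectoid.not_losing_of_forall_rich hopen hcover
    (fun _ _ h => h.rich hopen hcover) ⟨ω.isComponent ∅, hr⟩
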